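/- Let $\mathbb D$ be the open unit disc, $dm$ planar Lebesgue measure on $\mathbb D$ normalized so that $m(\mathbb D)=1$, and $\varphi_a(z)=\frac{a-z}{1-\bar a z}$ for $a\in\mathbb D$. For $p>0$ let $\mathcal D_p$ be the space of holomorphic $f$ on $\mathbb D$ with $$\|f\|_{\mathcal D_p}^2=|f(0)|^2+\int_{\mathbb D}|f'(z)|^2(1-|z|^2)^p\,dm(z)<\infty .$$ Let $\mathcal Q_p$ be the space of $f\in\mathcal D_p$ with $\sup_{a\in\mathbb D}\|f\circ\varphi_a-f(a)\|_{\mathcal D_p}<\infty$. For $p,\lambda\in(0,1)$ let $\mathcal D_p^\lambda$ be the space of holomorphic $f$ on $\mathbb D$ with $$\|f\|_{\mathcal D_p^\lambda}=|f(0)|+\sup_{a\in\mathbb D}(1-|a|^2)^{\frac p2(1-\lambda)}\|f\circ\varphi_a-f(a)\|_{\mathcal D_p}<\infty .$$ Let $\mathcal W_p$ be the space of holomorphic $g$ on $\mathbb D$ for which $|g'(z)|^2(1-|z|^2)^p\,dm(z)$ is a $\mathcal D_p$-Carleson measure, that is, for which there is a finite constant $C$ with $$\int_{\mathbb D}|f(z)|^2|g'(z)|^2(1-|z|^2)^p\,dm(z)\le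 C\|f\|_{\mathcal D_p}^2\quad\text{for all } f\in\mathcal D_p .$$ For holomorphic $f,g$ on $\mathbb D$ put $J_g(f)(z)=\int_0^z f(w)g'(w)\,dw$, $z\in\mathbb D$. **Theorem 3.4.** Suppose $0<p<1$. 1. If $0<q<p$ and $g\in\mathcal Q_q$, then $J_g:\mathcal D_p^{q/p}\to\mathcal D_p^{q/p}$ is bounded. 2. If $0<\lambda<1$ and $g\in\mathcal W_p$, then $J_g:\mathcal D_p^{\lambda}\to\mathcal D_p^{\lambda}$ is bounded. Here "$J_g$ is bounded on $\mathcal D_p^\lambda$" means that there is a finite constant $C$ such that $J_g(f)\in\mathcal D_p^\lambda$ and $\|J_g(f)\|_{\mathcal D_p^\lambda}\le C\|f\|_{\mathcal D_p^\lambda}$ for all $f\in\mathcal D_p^\lambda$. -/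

import Mathlib

/-! Function spaces on the open unit disc. A function on the disc is represented by a function
`ℂ → ℂ`; all the notions below depend only on its values on `Metric.ball 0 1`. Norms take values
in `[0, ∞]`, and membership in a space means holomorphy on the disc and finiteness of the norm. -/

open scoped ENNReal NNReal

noncomputable section

namespace DirichletMorrey

/-- The open unit disc. -/
abbrev disc : Set ℂ := Metric.ball (0 : ℂ) 1

/-- Planar Lebesgue measure on the unit disc, normalized so that the disc has measure `1`. -/
def discMeasure : MeasureTheory.Measure ℂ :=
  (ENNReal.ofReal Real.pi)⁻¹ • (MeasureTheory.volume.restrict disc)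

/-- The disc automorphism `φ_a(z) = (a - z) / (1 - conj a * z)`, exchanging `0` and `a`. -/
def phi (a z : ℂ) : ℂ := (a - z) / (1 - (starRingEnd ℂ) a * z)

/-- The hyperbolic translate `f ∘ φ_a - f(a)`. -/
def hypTranslate (f : ℂ → ℂ) (a : ℂ) : ℂ → ℂ := fun z => f (phi a z) - f a

/-- The density `|f'(z)|² (1 - |z|²)^p`. -/
def density (p : ℝ) (f : ℂ → ℂ) (z : ℂ) : ℝ≥0∞ :=
  ‖deriv f z‖ₑ ^ 2 * ENNReal.ofReal ((1 - ‖z‖ ^ 2) ^ p)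

/-- The norm of the weighted Dirichlet space `D_p`. -/
def dirichletNorm (p : ℝ) (f : ℂ → ℂ) : ℝ≥0∞ :=
  (‖f 0‖ₑ ^ 2 + ∫⁻ z, density p f z ∂discMeasure) ^ (1 / 2 : ℝ)

/-- `f` belongs to the weighted Dirichlet space `D_p`. -/
def MemDirichlet (p : ℝ) (f : ℂ → ℂ) : Prop :=
  DifferentiableOn ℂ f disc ∧ dirichletNorm p f < ∞

/-- `f` belongs to the space `Q_p`: `f ∈ D_p` and its hyperbolic translates are bounded
in the norm of `D_p`. -/
def MemQ (p : ℝ) (f : ℂ → ℂ) : Prop :=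
  MemDirichlet p f ∧ (⨆ a ∈ disc, dirichletNorm p (hypTranslate f a)) < ∞

/-- The norm of the Dirichlet-Morrey space with parameters `p` and `l`. -/
def morreyNorm (p l : ℝ) (f : ℂ → ℂ) : ℝ≥0∞ :=
  ‖f 0‖ₑ + ⨆ a ∈ disc,
    ENNReal.ofReal ((1 - ‖a‖ ^ 2) ^ (p / 2 * (1 - l))) * dirichletNorm p (hypTranslate f a)

/-- `f` belongs to the Dirichlet-Morrey space with parameters `p` and `l`. -/
def MemMorrey (p l : ℝ) (f : ℂ → ℂ) : Prop :=
  DifferentiableOn ℂ f disc ∧ morreyNorm p l f < ∞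

/-- `μ` (considered on the disc) is a `D_p`-Carleson measure. -/
def IsDirichletCarleson (p : ℝ) (μ : MeasureTheory.Measure ℂ) : Prop :=
  ∃ C : ℝ≥0, ∀ f : ℂ → ℂ, MemDirichlet p f →
    ∫⁻ z in disc, ‖f z‖ₑ ^ 2 ∂μ ≤ C * dirichletNorm p f ^ 2

/-- `g` belongs to `W_p`: `g` is holomorphic on the disc and `|g'(z)|² (1 - |z|²)^p dm(z)` is a
`D_p`-Carleson measure. -/
def MemW (p : ℝ) (g : ℂ → ℂ) : Prop :=
  DifferentiableOn ℂ g disc ∧ IsDirichletCarleson p (discMeasure.withDensity (density p g))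

/-- The integration operator `J_g f (z) = ∫_0^z f(w) g'(w) dw`, integrated along the segment
`w = t z`, `0 ≤ t ≤ 1`. -/
def J (g f : ℂ → ℂ) (z : ℂ) : ℂ :=
  ∫ t in (0 : ℝ)..1, f (t * z) * deriv g (t * z) * z

/-- The operator `T` maps the Dirichlet-Morrey space with parameters `p` and `l` into itself
and is bounded in its norm. -/
def IsBoundedOnMorrey (p l : ℝ) (T : (ℂ → ℂ) → (ℂ → ℂ)) : Prop :=
  ∃ C : ℝ≥0, ∀ f : ℂ → ℂ, MemMorrey p l f →
    MemMorrey p l (T f) ∧ morreyNorm p l (T f) ≤ C * morreyNorm p l f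

end DirichletMorrey

end

/-!
By the change of variables `z = φ_a(w)`, the squared `D_p`-norm of a hyperbolic translate
`f ∘ φ_a - f(a)` is the energy `∫ |f'|² (1 - |φ_a|²)^p dm`, and
`1 - |φ_a(z)|² = (1 - |a|²)(1 - |z|²) / |1 - conj a z|²`. Since `(J_g f)' = f g'`, both parts ask for
a bound, uniform in `a`, on `(1 - |a|²)^(p(1-λ)) ∫ |f|² |g'|² (1 - |φ_a|²)^p dm`.

The common ingredient is the growth estimate `|f(z)| ≤ C ‖f‖ (1 - |z|²)^(-p(1-λ)/2)`
(`exists_norm_le`). It comes from the area mean value property applied to `(f ∘ φ_a)'²`, which bounds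
`f'(a)` by the energy at `a`, followed by integration along a radius.

For `g ∈ Q_q` with `λ = q/p`, the growth estimate is inserted directly: as
`1 - |a|² ≤ 2 |1 - conj a z|`, the factor `(1 - |a|²)^(p-q) (1 - |z|²)^(-(p-q))` turns the weight
`(1 - |φ_a|²)^p` into at most `4^(p-q) (1 - |φ_a|²)^q` (`weight_exchange`), and what is left is the
energy of `g` with exponent `q`.

For `g ∈ W_p`, the Carleson inequality is tested on `F_a(z) = f(z) (1 - conj a z)^(-p)`. Its left side
is `(1 - |a|²)^(-p)` times the energy of `J_g f`, so it suffices that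
`(1 - |a|²)^(p(2-λ)) ‖F_a‖² ≤ M ‖f‖²` (`exists_dirichletNorm_testFun_le`). The part of `F_a'` with
`f'` is controlled by the energy of `f` at `a`. The part with `f` is controlled by the growth estimate
and the Forelli–Rudin bound `∫ |1 - conj a z|^(-2-s) dm ≤ K (1 - |a|²)^(-s)` with `s = p(2-λ)`
(`exists_lintegral_norm_denom_rpow_le`).
-/

noncomputable section

open MeasureTheory Set

namespace DirichletMorrey

/-! ### Disc automorphisms -/

lemma norm_lt_one_of_mem_disc {z : ℂ} (hz : z ∈ disc) : ‖z‖ < 1 := by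
  simpa using hz

lemma one_sub_norm_sq_pos {z : ℂ} (hz : z ∈ disc) : 0 < 1 - ‖z‖ ^ 2 := by
  nlinarith [norm_lt_one_of_mem_disc hz, norm_nonneg z]

lemma one_sub_norm_le {a z : ℂ} (hz : z ∈ disc) :
    1 - ‖a‖ ≤ ‖1 - (starRingEnd ℂ) a * z‖ := by
  have h := norm_sub_norm_le (1 : ℂ) ((starRingEnd ℂ) a * z)
  rw [norm_one, norm_mul, RCLike.norm_conj] at h
  nlinarith [norm_lt_one_of_mem_disc hz, norm_nonneg a]

lemma one_sub_norm_sq_le {a z : ℂ} (ha : a ∈ disc) (hz : z ∈ disc) :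
    1 - ‖a‖ ^ 2 ≤ 2 * ‖1 - (starRingEnd ℂ) a * z‖ := by
  nlinarith [one_sub_norm_le (a := a) hz, norm_lt_one_of_mem_disc ha, norm_nonneg a]

lemma one_sub_norm_sq_le_right {a z : ℂ} (ha : a ∈ disc) (hz : z ∈ disc) :
    1 - ‖z‖ ^ 2 ≤ 2 * ‖1 - (starRingEnd ℂ) a * z‖ := by
  have h : ‖1 - (starRingEnd ℂ) a * z‖ = ‖1 - (starRingEnd ℂ) z * a‖ := by
    rw [← RCLike.norm_conj]
    simp [mul_comm]
  rw [h]
  exact one_sub_norm_sq_le hz ha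

lemma norm_denom_pos {a z : ℂ} (ha : a ∈ disc) (hz : z ∈ disc) :
    0 < ‖1 - (starRingEnd ℂ) a * z‖ := by
  linarith [one_sub_norm_le (a := a) hz, norm_lt_one_of_mem_disc ha]

lemma denom_ne_zero {a z : ℂ} (ha : a ∈ disc) (hz : z ∈ disc) :
    1 - (starRingEnd ℂ) a * z ≠ 0 :=
  norm_pos_iff.1 (norm_denom_pos ha hz)

lemma one_sub_norm_phi_sq {a z : ℂ} (ha : a ∈ disc) (hz : z ∈ disc) :
    1 - ‖phi a z‖ ^ 2 =
      (1 - ‖a‖ ^ 2) * (1 - ‖z‖ ^ 2) / ‖1 - (starRingEnd ℂ) a * z‖ ^ 2 := by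
  have h0 := (norm_denom_pos ha hz).ne'
  rw [phi, norm_div, div_pow, eq_div_iff (by positivity), sub_mul,
    div_mul_cancel₀ _ (by positivity), one_mul]
  simp only [← Complex.normSq_eq_norm_sq, Complex.normSq_apply, Complex.sub_re, Complex.sub_im,
    Complex.mul_re, Complex.mul_im, Complex.conj_re, Complex.conj_im, Complex.one_re,
    Complex.one_im]
  ring

lemma phi_mem_disc {a z : ℂ} (ha : a ∈ disc) (hz : z ∈ disc) : phi a z ∈ disc := by
  have h : 0 < 1 - ‖phi a z‖ ^ 2 := by
    rw [one_sub_norm_phi_sq ha hz]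
    have := one_sub_norm_sq_pos ha
    have := one_sub_norm_sq_pos hz
    have := norm_denom_pos ha hz
    positivity
  rw [disc, mem_ball_zero_iff]
  nlinarith [norm_nonneg (phi a z)]

lemma phi_phi {a z : ℂ} (ha : a ∈ disc) (hz : z ∈ disc) : phi a (phi a z) = z := by
  have h0 := denom_ne_zero ha hz
  have h1 := denom_ne_zero ha ha
  simp only [phi]
  generalize (starRingEnd ℂ) a = b at *
  have h2 : 1 - b * ((a - z) / (1 - b * z)) = (1 - b * a) / (1 - b * z) := by
    rw [eq_div_iff h0, sub_mul, mul_assoc, div_mul_cancel₀ _ h0]; ring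
  have h3 : a - (a - z) / (1 - b * z) = z * (1 - b * a) / (1 - b * z) := by
    rw [eq_div_iff h0, sub_mul, div_mul_cancel₀ _ h0]; ring
  rw [h2, h3, div_div_div_cancel_right₀ h0, mul_div_cancel_right₀ _ h1]

lemma phi_zero (a : ℂ) : phi a 0 = a := by simp [phi]

/-- The derivative of the disc automorphism `φ_a`. -/
def phiDeriv (a z : ℂ) : ℂ := -(1 - (starRingEnd ℂ) a * a) / (1 - (starRingEnd ℂ) a * z) ^ 2

lemma hasDerivAt_phi {a z : ℂ} (ha : a ∈ disc) (hz : z ∈ disc) :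
    HasDerivAt (phi a) (phiDeriv a z) z := by
  have h0 := denom_ne_zero ha hz
  have h := ((hasDerivAt_id z).const_sub a).div
    (((hasDerivAt_id z).const_mul ((starRingEnd ℂ) a)).const_sub 1) h0
  refine h.congr_deriv ?_
  simp only [phiDeriv, id]
  congr 1
  ring

lemma bijOn_phi {a : ℂ} (ha : a ∈ disc) : BijOn (phi a) disc disc :=
  ⟨fun _ hz => phi_mem_disc ha hz,
    fun z hz w hw h => by rw [← phi_phi ha hz, h, phi_phi ha hw],
    fun z hz => ⟨phi a z, phi_mem_disc ha hz, phi_phi ha hz⟩⟩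

lemma lintegral_discMeasure (G : ℂ → ℝ≥0∞) :
    ∫⁻ z, G z ∂discMeasure = (ENNReal.ofReal Real.pi)⁻¹ * ∫⁻ z in disc, G z := by
  rw [discMeasure, lintegral_smul_measure, smul_eq_mul]

lemma ae_discMeasure : ∀ᵐ z ∂discMeasure, z ∈ disc :=
  Measure.ae_smul_measure (ae_restrict_mem Metric.isOpen_ball.measurableSet) _

lemma lintegral_discMeasure_mono {F G : ℂ → ℝ≥0∞} (h : ∀ z ∈ disc, F z ≤ G z) :
    ∫⁻ z, F z ∂discMeasure ≤ ∫⁻ z, G z ∂discMeasure :=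
  lintegral_mono_ae (ae_discMeasure.mono h)

lemma lintegral_discMeasure_congr {F G : ℂ → ℝ≥0∞} (h : ∀ z ∈ disc, F z = G z) :
    ∫⁻ z, F z ∂discMeasure = ∫⁻ z, G z ∂discMeasure :=
  lintegral_congr_ae (ae_discMeasure.mono h)

/-- The real Jacobian determinant of a holomorphic map is the squared modulus of its complex
derivative. -/
lemma abs_det_restrictScalars_smulRight (c : ℂ) :
    |((ContinuousLinearMap.toSpanSingleton ℂ c).restrictScalars ℝ).det| = ‖c‖ ^ 2 := by
  rw [ContinuousLinearMap.det]
  have : ((((ContinuousLinearMap.toSpanSingleton ℂ c).restrictScalars ℝ : ℂ →L[ℝ] ℂ)) :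
      ℂ →ₗ[ℝ] ℂ) = LinearMap.mulLeft ℝ c := by
    ext; simp [mul_comm]
  rw [this, ← Complex.normSq_eq_norm_sq, ← LinearMap.det_toMatrix Complex.basisOneI,
    Matrix.det_fin_two]
  simp only [LinearMap.toMatrix_apply, LinearMap.mulLeft_apply, Complex.coe_basisOneI,
    Complex.coe_basisOneI_repr]
  simp [Complex.normSq_apply]
  exact add_nonneg (mul_self_nonneg c.re) (mul_self_nonneg c.im)

/-- Change of variables `z = φ_a(w)` on the disc. -/
lemma lintegral_comp_phi {a : ℂ} (ha : a ∈ disc) (G : ℂ → ℝ≥0∞) :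
    ∫⁻ z, G z ∂discMeasure = ∫⁻ w, ‖phiDeriv a w‖ₑ ^ 2 * G (phi a w) ∂discMeasure := by
  rw [lintegral_discMeasure, lintegral_discMeasure]
  congr 1
  have h := lintegral_image_eq_lintegral_abs_det_fderiv_mul volume (s := disc) (f := phi a)
    Metric.isOpen_ball.measurableSet
    (f' := fun w => (ContinuousLinearMap.toSpanSingleton ℂ (phiDeriv a w)).restrictScalars ℝ)
    (fun w hw => ((hasDerivAt_phi ha hw).hasFDerivAt.restrictScalars ℝ).hasFDerivWithinAt)
    (bijOn_phi ha).injOn G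
  rw [(bijOn_phi ha).image_eq] at h
  rw [h]
  congr 1
  ext w
  rw [abs_det_restrictScalars_smulRight, ENNReal.ofReal_pow (norm_nonneg _), ofReal_norm]

/-! ### Energies of hyperbolic translates -/

/-- The Möbius-weighted Dirichlet integral `∫ |f'|² (1 - |φ_a|²)^p dm`. -/
def energy (p : ℝ) (a : ℂ) (f : ℂ → ℂ) : ℝ≥0∞ :=
  ∫⁻ z, ‖deriv f z‖ₑ ^ 2 * ENNReal.ofReal ((1 - ‖phi a z‖ ^ 2) ^ p) ∂discMeasure

lemma deriv_hypTranslate {f : ℂ → ℂ} (hf : DifferentiableOn ℂ f disc) {a z : ℂ} (ha : a ∈ disc)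
    (hz : z ∈ disc) : deriv (hypTranslate f a) z = deriv f (phi a z) * phiDeriv a z := by
  have h1 : HasDerivAt f (deriv f (phi a z)) (phi a z) :=
    (hf.differentiableAt (Metric.isOpen_ball.mem_nhds (phi_mem_disc ha hz))).hasDerivAt
  exact ((h1.comp z (hasDerivAt_phi ha hz)).sub_const (f a)).deriv

lemma lintegral_density_hypTranslate (p : ℝ) {f : ℂ → ℂ} (hf : DifferentiableOn ℂ f disc) {a : ℂ}
    (ha : a ∈ disc) : ∫⁻ z, density p (hypTranslate f a) z ∂discMeasure = energy p a f := by
  rw [energy]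
  refine Eq.trans ?_ (lintegral_comp_phi ha _).symm
  refine lintegral_discMeasure_congr fun z hz => ?_
  rw [density, deriv_hypTranslate hf ha hz, phi_phi ha hz, enorm_mul, mul_pow]
  ring

/-- The squared `D_p`-norm of `f ∘ φ_a - f(a)` is the energy of `f` at `a`: the translate vanishes
at the origin. -/
lemma dirichletNorm_hypTranslate (p : ℝ) {f : ℂ → ℂ} (hf : DifferentiableOn ℂ f disc) {a : ℂ}
    (ha : a ∈ disc) : dirichletNorm p (hypTranslate f a) = energy p a f ^ (1 / 2 : ℝ) := by
  rw [dirichletNorm, lintegral_density_hypTranslate p hf ha]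
  simp [hypTranslate, phi_zero]

lemma rpow_half_sq (x : ℝ≥0∞) : (x ^ (1 / 2 : ℝ)) ^ 2 = x := by
  rw [← ENNReal.rpow_natCast, ← ENNReal.rpow_mul]
  norm_num

lemma dirichletNorm_sq (p : ℝ) (f : ℂ → ℂ) :
    dirichletNorm p f ^ 2 = ‖f 0‖ₑ ^ 2 + ∫⁻ z, density p f z ∂discMeasure :=
  rpow_half_sq _

lemma ofReal_rpow_sq {x : ℝ} (hx : 0 < x) (s : ℝ) :
    ENNReal.ofReal (x ^ s) ^ 2 = ENNReal.ofReal (x ^ (2 * s)) := by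
  rw [← ENNReal.ofReal_pow (by positivity), ← Real.rpow_natCast, ← Real.rpow_mul hx.le]
  norm_num [mul_comm]

lemma energy_le_of_memMorrey {p l : ℝ} {f : ℂ → ℂ} (hf : DifferentiableOn ℂ f disc) {a : ℂ}
    (ha : a ∈ disc) :
    ENNReal.ofReal ((1 - ‖a‖ ^ 2) ^ (p * (1 - l))) * energy p a f ≤ morreyNorm p l f ^ 2 := by
  have h : ENNReal.ofReal ((1 - ‖a‖ ^ 2) ^ (p / 2 * (1 - l))) *
      dirichletNorm p (hypTranslate f a) ≤ morreyNorm p l f :=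
    (le_iSup₂ (f := fun a (_ : a ∈ disc) => ENNReal.ofReal ((1 - ‖a‖ ^ 2) ^ (p / 2 * (1 - l))) *
      dirichletNorm p (hypTranslate f a)) a ha).trans le_add_self
  have h2 := pow_le_pow_left' h 2
  rw [mul_pow, ofReal_rpow_sq (one_sub_norm_sq_pos ha), dirichletNorm_hypTranslate p hf ha,
    rpow_half_sq] at h2
  rwa [show 2 * (p / 2 * (1 - l)) = p * (1 - l) by ring] at h2

lemma morreyNorm_le_of_energy_le {p l : ℝ} {f : ℂ → ℂ} (hf : DifferentiableOn ℂ f disc)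
    {K : ℝ≥0∞} (hK : ∀ a ∈ disc,
      ENNReal.ofReal ((1 - ‖a‖ ^ 2) ^ (p * (1 - l))) * energy p a f ≤ K ^ 2) :
    morreyNorm p l f ≤ ‖f 0‖ₑ + K := by
  refine add_le_add le_rfl (iSup₂_le fun a ha => ?_)
  refine (ENNReal.pow_le_pow_left_iff (n := 2) two_ne_zero).1 ?_
  rw [mul_pow, ofReal_rpow_sq (one_sub_norm_sq_pos ha), dirichletNorm_hypTranslate p hf ha,
    rpow_half_sq, show 2 * (p / 2 * (1 - l)) = p * (1 - l) by ring]
  exact hK a ha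

/-- Factorization of the weight `(1 - |φ_a|²)^p`. -/
lemma one_sub_norm_phi_sq_rpow (p : ℝ) {a z : ℂ} (ha : a ∈ disc) (hz : z ∈ disc) :
    (1 - ‖phi a z‖ ^ 2) ^ p = (1 - ‖a‖ ^ 2) ^ p *
      ((1 - ‖z‖ ^ 2) ^ p * ‖1 - (starRingEnd ℂ) a * z‖ ^ (-(2 * p))) := by
  have h1 := one_sub_norm_sq_pos ha
  have h2 := one_sub_norm_sq_pos hz
  have h3 := norm_denom_pos ha hz
  rw [one_sub_norm_phi_sq ha hz, Real.div_rpow (by positivity) (by positivity),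
    Real.mul_rpow h1.le h2.le, ← Real.rpow_two ‖1 - _‖, ← Real.rpow_mul h3.le, Real.rpow_neg h3.le,
    div_eq_mul_inv, mul_assoc]

lemma energy_eq (p : ℝ) {a : ℂ} (ha : a ∈ disc) (f : ℂ → ℂ) :
    energy p a f = ENNReal.ofReal ((1 - ‖a‖ ^ 2) ^ p) *
      ∫⁻ z, ‖deriv f z‖ₑ ^ 2 * ENNReal.ofReal
        ((1 - ‖z‖ ^ 2) ^ p * ‖1 - (starRingEnd ℂ) a * z‖ ^ (-(2 * p))) ∂discMeasure := by
  rw [← lintegral_const_mul' _ _ ENNReal.ofReal_ne_top, energy]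
  refine lintegral_discMeasure_congr fun z hz => ?_
  rw [one_sub_norm_phi_sq_rpow p ha hz,
    ENNReal.ofReal_mul (Real.rpow_nonneg (one_sub_norm_sq_pos ha).le _)]
  ring

/-! ### The area mean value property and growth of Morrey functions -/

/-- Sub-mean value property of `|G|` on a circle centred at the origin. -/
lemma two_pi_mul_enorm_le_lintegral_circle {G : ℂ → ℂ} (hG : DifferentiableOn ℂ G disc) {r : ℝ}
    (hr0 : 0 < r) (hr1 : r < 1) :
    ENNReal.ofReal (2 * Real.pi) * ‖G 0‖ₑ ≤
      ∫⁻ θ in Ioo (-Real.pi) Real.pi, ‖G (Complex.polarCoord.symm (r, θ))‖ₑ := by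
  have hcl : Metric.closedBall (0 : ℂ) |r| ⊆ disc := by
    rw [abs_of_pos hr0]; exact Metric.closedBall_subset_ball hr1
  have hd : DiffContOnCl ℂ G (Metric.ball 0 |r|) :=
    (hG.mono (Metric.closure_ball_subset_closedBall.trans hcl)).diffContOnCl
  have h1 := hd.circleAverage
  rw [Real.circleAverage_def] at h1
  have hper : Function.Periodic (fun θ => G (circleMap 0 r θ)) (2 * Real.pi) := fun θ => by
    simp only [periodic_circleMap 0 r θ]
  have h2 := hper.intervalIntegral_add_eq 0 (-Real.pi)
  rw [zero_add, show -Real.pi + 2 * Real.pi = Real.pi by ring] at h2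
  rw [h2] at h1
  have h3 : ((2 * Real.pi : ℝ)) • G 0 = ∫ θ in (-Real.pi)..Real.pi, G (circleMap 0 r θ) := by
    rw [← h1, smul_smul, mul_inv_cancel₀ (by positivity), one_smul]
  have h4 : ENNReal.ofReal (2 * Real.pi) * ‖G 0‖ₑ = ‖(2 * Real.pi : ℝ) • G 0‖ₑ := by
    rw [enorm_smul, Real.enorm_of_nonneg (by positivity)]
  rw [h4, h3, intervalIntegral.integral_of_le (by linarith [Real.pi_pos])]
  refine (enorm_integral_le_lintegral_enorm _).trans_eq ?_
  rw [← restrict_Ioo_eq_restrict_Ioc]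
  refine lintegral_congr fun θ => ?_
  rw [circleMap_zero, Complex.polarCoord_symm_apply, Complex.exp_mul_I, Complex.ofReal_cos,
    Complex.ofReal_sin]

/-- Weighted area sub-mean value property for a radial weight, by polar coordinates. -/
lemma enorm_mul_lintegral_le_lintegral {G : ℂ → ℂ} (hG : DifferentiableOn ℂ G disc)
    (hm : Measurable G) {w : ℝ → ℝ≥0∞} (hw : Measurable w) :
    ‖G 0‖ₑ * ∫⁻ z, w ‖z‖ ∂discMeasure ≤ ∫⁻ z, ‖G z‖ₑ * w ‖z‖ ∂discMeasure := by
  rw [← lintegral_const_mul' _ _ enorm_ne_top, lintegral_discMeasure, lintegral_discMeasure]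
  refine mul_le_mul_right ?_ _
  have key : ∀ H : ℂ → ℂ, Measurable H → ∫⁻ z in disc, ‖H z‖ₑ * w ‖z‖ =
      ∫⁻ r in Ioi (0 : ℝ), (Iio 1).indicator (fun r => ENNReal.ofReal r * w r *
        ∫⁻ θ in Ioo (-Real.pi) Real.pi, ‖H (Complex.polarCoord.symm (r, θ))‖ₑ) r := by
    intro H hH
    have hsymm : Measurable fun p : ℝ × ℝ => Complex.polarCoord.symm p := by
      simp only [Complex.polarCoord_symm_apply]
      fun_prop
    rw [← lintegral_indicator Metric.isOpen_ball.measurableSet,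
      ← Complex.lintegral_comp_polarCoord_symm, polarCoord_target, Measure.volume_eq_prod,
      ← Measure.prod_restrict, lintegral_prod]
    · refine setLIntegral_congr_fun measurableSet_Ioi fun r (hr : 0 < r) => ?_
      have hmem : ∀ θ, Complex.polarCoord.symm (r, θ) ∈ disc ↔ r < 1 := fun θ => by
        rw [disc, mem_ball_zero_iff, Complex.norm_polarCoord_symm, abs_of_pos hr]
      by_cases h1 : r < 1
      · simp only [indicator_of_mem (show r ∈ Iio (1 : ℝ) from h1)]
        rw [← lintegral_const_mul _ (by fun_prop)]
        refine lintegral_congr fun θ => ?_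
        rw [indicator_of_mem ((hmem θ).2 h1), Complex.norm_polarCoord_symm, abs_of_pos hr,
          smul_eq_mul]
        ring
      · simp only [indicator_of_notMem (show r ∉ Iio (1 : ℝ) from h1)]
        refine (lintegral_congr fun θ => ?_).trans lintegral_zero
        rw [indicator_of_notMem (fun h => h1 ((hmem θ).1 h)), smul_zero]
    · have h2 : Measurable (disc.indicator fun z => ‖H z‖ₑ * w ‖z‖) :=
        Measurable.indicator (by fun_prop) Metric.isOpen_ball.measurableSet
      exact Measurable.aemeasurable
        ((ENNReal.measurable_ofReal.comp measurable_fst).smul (h2.comp hsymm))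
  rw [key G hm, key (fun _ => G 0) measurable_const]
  refine setLIntegral_mono' measurableSet_Ioi fun r (hr : 0 < r) => ?_
  by_cases h1 : r < 1
  · simp only [indicator_of_mem (show r ∈ Iio (1 : ℝ) from h1)]
    refine mul_le_mul_right ?_ _
    refine le_trans (le_of_eq ?_) (two_pi_mul_enorm_le_lintegral_circle hG hr h1)
    rw [setLIntegral_const, Real.volume_Ioo, mul_comm]
    congr 2
    ring
  · simp only [indicator_of_notMem (show r ∉ Iio (1 : ℝ) from h1), le_refl]

/-- The mass `∫ (1 - |z|²)^p dm`. -/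
def weightMass (p : ℝ) : ℝ≥0∞ := ∫⁻ z, ENNReal.ofReal ((1 - ‖z‖ ^ 2) ^ p) ∂discMeasure

lemma discMeasure_univ : discMeasure univ = 1 := by
  rw [discMeasure, Measure.smul_apply, Measure.restrict_apply_univ, Complex.volume_ball,
    smul_eq_mul]
  simp only [ENNReal.ofReal_one, one_pow, one_mul]
  rw [← ENNReal.ofReal_coe_nnreal, NNReal.coe_real_pi]
  exact ENNReal.inv_mul_cancel (by simp [Real.pi_pos]) ENNReal.ofReal_ne_top

lemma weightMass_pos (p : ℝ) : 0 < weightMass p := by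
  rw [weightMass, lintegral_pos_iff_support (by fun_prop)]
  refine lt_of_lt_of_le (b := discMeasure disc) ?_ (measure_mono fun z hz => ?_)
  · rw [show discMeasure disc = discMeasure univ by simp [discMeasure], discMeasure_univ]
    exact one_pos
  · simpa using Real.rpow_pos_of_pos (one_sub_norm_sq_pos hz) p

lemma weightMass_ne_top {p : ℝ} (hp : 0 < p) : weightMass p ≠ ∞ := by
  refine ne_top_of_le_ne_top (b := ∫⁻ _, 1 ∂discMeasure) (by simp [discMeasure_univ])
    (lintegral_discMeasure_mono fun z hz => ?_)
  rw [ENNReal.ofReal_le_one]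
  exact Real.rpow_le_one (one_sub_norm_sq_pos hz).le (by nlinarith [sq_nonneg ‖z‖]) hp.le

/-- The area sub-mean value property for the holomorphic function `h'²`. -/
lemma deriv_zero_sq_mul_weightMass_le (p : ℝ) {h : ℂ → ℂ} (hh : DifferentiableOn ℂ h disc) :
    ‖deriv h 0‖ₑ ^ 2 * weightMass p ≤ ∫⁻ z, density p h z ∂discMeasure := by
  have := enorm_mul_lintegral_le_lintegral (G := fun z => deriv h z ^ 2)
    ((hh.deriv Metric.isOpen_ball).pow 2) ((measurable_deriv h).pow_const 2)
    (w := fun r => ENNReal.ofReal ((1 - r ^ 2) ^ p)) (by fun_prop)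
  simp only [enorm_pow] at this
  exact this

lemma differentiableOn_hypTranslate {f : ℂ → ℂ} (hf : DifferentiableOn ℂ f disc) {a : ℂ}
    (ha : a ∈ disc) : DifferentiableOn ℂ (hypTranslate f a) disc := fun z hz => by
  have h1 : DifferentiableAt ℂ f (phi a z) :=
    hf.differentiableAt (Metric.isOpen_ball.mem_nhds (phi_mem_disc ha hz))
  exact ((h1.comp z (hasDerivAt_phi ha hz).differentiableAt).sub_const _).differentiableWithinAt

/-- The derivative at `a` is bounded by the energy at `a`, because
`(f ∘ φ_a)'(0) = -(1 - |a|²) f'(a)`. -/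
lemma deriv_sq_mul_weightMass_le_energy (p : ℝ) {f : ℂ → ℂ} (hf : DifferentiableOn ℂ f disc)
    {a : ℂ} (ha : a ∈ disc) :
    ENNReal.ofReal ((‖deriv f a‖ * (1 - ‖a‖ ^ 2)) ^ 2) * weightMass p ≤ energy p a f := by
  have h := deriv_zero_sq_mul_weightMass_le p (differentiableOn_hypTranslate hf ha)
  rw [lintegral_density_hypTranslate p hf ha,
    deriv_hypTranslate hf ha (Metric.mem_ball_self one_pos), phi_zero] at h
  refine le_trans (le_of_eq ?_) h
  congr 1
  have h2 : ‖phiDeriv a 0‖ = 1 - ‖a‖ ^ 2 := by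
    rw [phiDeriv, mul_zero, sub_zero, one_pow, div_one, norm_neg, mul_comm, Complex.mul_conj,
      Complex.normSq_eq_norm_sq, ← Complex.ofReal_one, ← Complex.ofReal_sub,
      Complex.norm_of_nonneg (one_sub_norm_sq_pos ha).le]
  rw [← h2, ← norm_mul, ENNReal.ofReal_pow (norm_nonneg _), ofReal_norm]

/-- Pointwise bound `|f'(a)| ≤ c N (1 - |a|²)^(-1-s)` with `s = p (1 - l) / 2`. -/
lemma exists_norm_deriv_le {p : ℝ} (hp : 0 < p) (l : ℝ) :
    ∃ c : ℝ, 0 < c ∧ ∀ f, MemMorrey p l f → ∀ a ∈ disc,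
      ‖deriv f a‖ ≤ c * (morreyNorm p l f).toReal * (1 - ‖a‖ ^ 2) ^ (-(p / 2 * (1 - l)) - 1) := by
  set m := (weightMass p).toReal with hm
  have hm0 : 0 < m := ENNReal.toReal_pos (weightMass_pos p).ne' (weightMass_ne_top hp)
  refine ⟨(Real.sqrt m)⁻¹, by positivity, fun f hf a ha => ?_⟩
  have hx := one_sub_norm_sq_pos ha
  set x := 1 - ‖a‖ ^ 2 with hxdef
  set N := (morreyNorm p l f).toReal with hN
  have hNe : morreyNorm p l f = ENNReal.ofReal N := (ENNReal.ofReal_toReal hf.2.ne).symm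
  have hme : weightMass p = ENNReal.ofReal m := (ENNReal.ofReal_toReal (weightMass_ne_top hp)).symm
  have h := (mul_le_mul_right (deriv_sq_mul_weightMass_le_energy p hf.1 ha) _).trans
    (energy_le_of_memMorrey (p := p) (l := l) hf.1 ha)
  have hN0 : 0 ≤ N := ENNReal.toReal_nonneg
  rw [hNe, hme, ← ENNReal.ofReal_mul (by positivity), ← ENNReal.ofReal_mul (by positivity),
    ← ENNReal.ofReal_pow hN0, ENNReal.ofReal_le_ofReal_iff (by positivity)] at h
  have h2 : (Real.sqrt m * (‖deriv f a‖ * (x * x ^ (p / 2 * (1 - l))))) ^ 2 ≤ N ^ 2 := by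
    refine le_trans (le_of_eq ?_) h
    rw [mul_pow, Real.sq_sqrt hm0.le, show p * (1 - l) = p / 2 * (1 - l) + p / 2 * (1 - l) by ring,
      Real.rpow_add hx]
    ring
  have h3 := (sq_le_sq₀ (by positivity) hN0).1 h2
  rw [sub_eq_add_neg, ← neg_add, Real.rpow_neg hx.le, Real.rpow_add hx, Real.rpow_one]
  rw [mul_comm _ N, mul_assoc, ← mul_inv, ← div_eq_mul_inv, le_div_iff₀ (by positivity)]
  refine le_trans (le_of_eq ?_) h3
  ring

/-- Growth of Morrey functions: `|f(z)| ≤ C ‖f‖ (1 - |z|²)^(-p(1-l)/2)`. -/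
lemma exists_norm_le {p l : ℝ} (hp : 0 < p) (hl : l < 1) :
    ∃ C : ℝ, 0 < C ∧ ∀ f, MemMorrey p l f → ∀ z ∈ disc,
      ‖f z‖ ≤ C * (morreyNorm p l f).toReal * (1 - ‖z‖ ^ 2) ^ (-(p / 2 * (1 - l))) := by
  obtain ⟨c, hc, hd⟩ := exists_norm_deriv_le hp l
  set s := p / 2 * (1 - l) with hs
  have hs0 : 0 < s := by
    have : 0 < 1 - l := by linarith
    positivity
  refine ⟨(1 + c / s) * 2 ^ s, by positivity, fun f hf z hz => ?_⟩
  set N := (morreyNorm p l f).toReal with hN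
  have hN0 : 0 ≤ N := ENNReal.toReal_nonneg
  have hz1 := norm_lt_one_of_mem_disc hz
  have hf0 : ‖f 0‖ ≤ N := by
    rw [← toReal_enorm]
    exact ENNReal.toReal_mono hf.2.ne le_self_add
  have hmem : ∀ t ∈ Icc (0 : ℝ) 1, (t : ℂ) * z ∈ disc := fun t ht => by
    rw [disc, mem_ball_zero_iff, norm_mul, Complex.norm_real, Real.norm_of_nonneg ht.1]
    nlinarith [ht.2, norm_nonneg z]
  have hpos : ∀ t ∈ Icc (0 : ℝ) 1, 0 < 1 - t * ‖z‖ := fun t ht => by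
    nlinarith [ht.1, ht.2, norm_nonneg z]
  have hder : ∀ t ∈ Icc (0 : ℝ) 1,
      HasDerivAt (fun t : ℝ => f (t * z)) (deriv f (t * z) * z) t := fun t ht => by
    have h1 : HasDerivAt f (deriv f (t * z)) (t * z) :=
      (hf.1.differentiableAt (Metric.isOpen_ball.mem_nhds (hmem t ht))).hasDerivAt
    have h2 : HasDerivAt (fun t : ℝ => (t : ℂ) * z) z t := by
      simpa using (Complex.ofRealCLM.hasDerivAt (x := t)).mul_const z
    exact h1.comp t h2
  have hB : ∀ t ∈ Icc (0 : ℝ) 1, HasDerivAt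
      (fun t : ℝ => ‖f 0‖ + c * N / s * (1 - t * ‖z‖) ^ (-s))
      (c * N * ‖z‖ * (1 - t * ‖z‖) ^ (-s - 1)) t := fun t ht => by
    have h1 := ((((hasDerivAt_id t).mul_const ‖z‖).const_sub 1).rpow_const (p := -s)
      (Or.inl (hpos t ht).ne')).const_mul (c * N / s) |>.const_add ‖f 0‖
    refine h1.congr_deriv ?_
    simp only [id]
    field_simp
  have hfin := image_norm_le_of_norm_deriv_right_le_deriv_boundary' (a := 0) (b := 1)
    (f := fun t : ℝ => f (t * z)) (f' := fun t => deriv f (t * z) * z)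
    (B := fun t : ℝ => ‖f 0‖ + c * N / s * (1 - t * ‖z‖) ^ (-s))
    (B' := fun t => c * N * ‖z‖ * (1 - t * ‖z‖) ^ (-s - 1))
    (fun t ht => (hder t ht).continuousAt.continuousWithinAt)
    (fun t ht => (hder t (Ico_subset_Icc_self ht)).hasDerivWithinAt)
    (by
      simp only [Complex.ofReal_zero, zero_mul, sub_zero, Real.one_rpow]
      have : 0 ≤ c * N / s := by positivity
      linarith)
    (fun t ht => (hB t ht).continuousAt.continuousWithinAt)
    (fun t ht => (hB t (Ico_subset_Icc_self ht)).hasDerivWithinAt)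
    (fun t ht => by
      have ht' := Ico_subset_Icc_self ht
      rw [norm_mul]
      refine (mul_le_mul_of_nonneg_right (hd f hf _ (hmem t ht')) (norm_nonneg z)).trans ?_
      have h1 : ‖(t : ℂ) * z‖ = t * ‖z‖ := by
        rw [norm_mul, Complex.norm_real, Real.norm_of_nonneg ht'.1]
      have h2 : (1 - ‖(t : ℂ) * z‖ ^ 2) ^ (-s - 1) ≤ (1 - t * ‖z‖) ^ (-s - 1) := by
        refine Real.rpow_le_rpow_of_nonpos (hpos t ht') ?_ (by linarith)
        rw [h1]
        have := hpos t ht'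
        have : 0 ≤ t * ‖z‖ := mul_nonneg ht'.1 (norm_nonneg z)
        nlinarith
      calc c * N * (1 - ‖(t : ℂ) * z‖ ^ 2) ^ (-s - 1) * ‖z‖
          ≤ c * N * (1 - t * ‖z‖) ^ (-s - 1) * ‖z‖ := by gcongr
        _ = _ := by ring)
    (right_mem_Icc.2 zero_le_one)
  simp only [Complex.ofReal_one, one_mul] at hfin
  have hz2 : 0 < 1 - ‖z‖ := by linarith
  have hz3 : 1 ≤ (1 - ‖z‖) ^ (-s) :=
    Real.one_le_rpow_of_pos_of_le_one_of_nonpos hz2 (by linarith [norm_nonneg z]) (by linarith)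
  have hz4 : (1 - ‖z‖) ^ (-s) ≤ 2 ^ s * (1 - ‖z‖ ^ 2) ^ (-s) := by
    have h1 : (2 * (1 - ‖z‖)) ^ (-s) ≤ (1 - ‖z‖ ^ 2) ^ (-s) :=
      Real.rpow_le_rpow_of_nonpos (one_sub_norm_sq_pos hz) (by nlinarith [norm_nonneg z])
        (by linarith)
    rw [Real.mul_rpow two_pos.le hz2.le, Real.rpow_neg two_pos.le] at h1
    rwa [inv_mul_le_iff₀ (by positivity)] at h1
  calc ‖f z‖ ≤ ‖f 0‖ + c * N / s * (1 - ‖z‖) ^ (-s) := hfin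
    _ ≤ N * (1 - ‖z‖) ^ (-s) + c * N / s * (1 - ‖z‖) ^ (-s) := by nlinarith
    _ = (1 + c / s) * N * (1 - ‖z‖) ^ (-s) := by ring
    _ ≤ (1 + c / s) * N * (2 ^ s * (1 - ‖z‖ ^ 2) ^ (-s)) := by gcongr
    _ = _ := by ring

/-! ### A Forelli–Rudin estimate -/

/-- The kernel is bounded below by a multiple of `(1 - |a|) + |z - u|`, where `u` is the boundary point
`a / |a|`; after a translation by `u` and a dilation by `1 - |a|` the integral over the whole plane
converges, with the stated power of `1 - |a|` from the scaling. -/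
lemma exists_lintegral_norm_denom_rpow_le {s : ℝ} (hs : 0 < s) :
    ∃ K : ℝ≥0, ∀ a ∈ disc,
      ∫⁻ z, ENNReal.ofReal (‖1 - (starRingEnd ℂ) a * z‖ ^ (-(2 + s))) ∂discMeasure ≤
        K * ENNReal.ofReal ((1 - ‖a‖ ^ 2) ^ (-s)) := by
  have hfin : ∫⁻ x : ℂ, ENNReal.ofReal ((1 + ‖x‖) ^ (-(2 + s))) < ∞ :=
    finite_integral_one_add_norm (by rw [Complex.finrank_real_complex]; push_cast; linarith)
  set I := ∫⁻ x : ℂ, ENNReal.ofReal ((1 + ‖x‖) ^ (-(2 + s))) with hI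
  set P := (ENNReal.ofReal Real.pi)⁻¹ with hP
  have hPtop : P ≠ ∞ := ENNReal.inv_ne_top.2 (by simp [Real.pi_pos])
  refine ⟨(P * (ENNReal.ofReal (3 ^ (2 + s) * 2 ^ s) * I)).toNNReal, fun a ha => ?_⟩
  rw [ENNReal.coe_toNNReal (ENNReal.mul_ne_top hPtop
    (ENNReal.mul_ne_top ENNReal.ofReal_ne_top hfin.ne)), lintegral_discMeasure, mul_assoc]
  refine mul_le_mul_right ?_ _
  have hna := norm_lt_one_of_mem_disc ha
  set δ := 1 - ‖a‖ with hδ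
  have hδ0 : 0 < δ := by rw [hδ]; linarith
  obtain ⟨u, hu1, hua⟩ : ∃ u : ℂ, ‖u‖ = 1 ∧ a = ‖a‖ * u := by
    rcases eq_or_ne a 0 with rfl | h
    · exact ⟨1, by simp, by simp⟩
    · have h' : (‖a‖ : ℂ) ≠ 0 := by simpa using h
      exact ⟨a / ‖a‖, by simp [h], by field_simp⟩
  have hlow : ∀ z ∈ disc, (δ + ‖z - u‖) / 3 ≤ ‖1 - (starRingEnd ℂ) a * z‖ := fun z hz => by
    have h1 := one_sub_norm_le (a := a) hz
    have h2 : ‖z - u‖ = ‖1 - (starRingEnd ℂ) u * z‖ := by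
      have huu : (starRingEnd ℂ) u * u = 1 := by
        rw [mul_comm, Complex.mul_conj, Complex.normSq_eq_norm_sq, hu1]; simp
      rw [← huu, ← mul_sub, norm_mul, RCLike.norm_conj, hu1, one_mul, norm_sub_rev]
    have h3 : ‖1 - (starRingEnd ℂ) u * z‖ ≤ ‖1 - (starRingEnd ℂ) a * z‖ + δ := by
      have h4 : 1 - (starRingEnd ℂ) u * z =
          (1 - (starRingEnd ℂ) a * z) + -((δ : ℂ) * ((starRingEnd ℂ) u * z)) := by
        have : (starRingEnd ℂ) a = ‖a‖ * (starRingEnd ℂ) u := by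
          conv_lhs => rw [hua]
          simp
        rw [this, hδ]; push_cast; ring
      rw [h4]
      refine (norm_add_le _ _).trans ?_
      gcongr
      rw [norm_neg, norm_mul, norm_mul, RCLike.norm_conj, hu1, Complex.norm_real,
        Real.norm_of_nonneg hδ0.le]
      nlinarith [norm_lt_one_of_mem_disc hz, norm_nonneg z]
    rw [h2]
    linarith
  have hscale : ∫⁻ x : ℂ, ENNReal.ofReal ((δ + ‖x‖) ^ (-(2 + s))) =
      ENNReal.ofReal (δ ^ (-s)) * I := by
    have h1 := lintegral_map (μ := (volume : Measure ℂ)) (g := fun x : ℂ => δ • x)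
      (f := fun x => ENNReal.ofReal ((δ + ‖x‖) ^ (-(2 + s)))) (by fun_prop) (by fun_prop)
    rw [Measure.map_addHaar_smul _ hδ0.ne', lintegral_smul_measure, smul_eq_mul,
      Complex.finrank_real_complex] at h1
    have h2 : ∀ x : ℂ, ENNReal.ofReal ((δ + ‖δ • x‖) ^ (-(2 + s))) =
        ENNReal.ofReal (δ ^ (-(2 + s))) * ENNReal.ofReal ((1 + ‖x‖) ^ (-(2 + s))) := fun x => by
      rw [← ENNReal.ofReal_mul (by positivity), norm_smul, Real.norm_of_nonneg hδ0.le,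
        ← Real.mul_rpow hδ0.le (by positivity)]
      ring_nf
    simp only [h2] at h1
    rw [lintegral_const_mul' _ _ ENNReal.ofReal_ne_top, abs_of_pos (by positivity), ← hI] at h1
    have h3 : ENNReal.ofReal (δ ^ 2) * ENNReal.ofReal ((δ ^ 2)⁻¹) = 1 := by
      rw [← ENNReal.ofReal_mul (by positivity), mul_inv_cancel₀ (by positivity),
        ENNReal.ofReal_one]
    rw [← one_mul (∫⁻ x : ℂ, _), ← h3, mul_assoc, h1, ← mul_assoc,
      ← ENNReal.ofReal_mul (by positivity), ← Real.rpow_two, ← Real.rpow_add hδ0]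
    congr 3
    ring
  calc ∫⁻ z in disc, ENNReal.ofReal (‖1 - (starRingEnd ℂ) a * z‖ ^ (-(2 + s)))
      ≤ ∫⁻ z in disc, ENNReal.ofReal (3 ^ (2 + s)) *
          ENNReal.ofReal ((δ + ‖z - u‖) ^ (-(2 + s))) := by
        refine setLIntegral_mono' Metric.isOpen_ball.measurableSet fun z hz => ?_
        rw [← ENNReal.ofReal_mul (by positivity)]
        refine ENNReal.ofReal_le_ofReal ?_
        have h1 := Real.rpow_le_rpow_of_nonpos (by positivity) (hlow z hz)
          (show -(2 + s) ≤ 0 by linarith)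
        refine h1.trans (le_of_eq ?_)
        rw [Real.div_rpow (by positivity) (by norm_num), Real.rpow_neg (by norm_num : (0:ℝ) ≤ 3),
          div_inv_eq_mul, mul_comm]
    _ ≤ ∫⁻ z, ENNReal.ofReal (3 ^ (2 + s)) *
          ENNReal.ofReal ((δ + ‖z - u‖) ^ (-(2 + s))) := setLIntegral_le_lintegral _ _
    _ = ENNReal.ofReal (3 ^ (2 + s)) * (ENNReal.ofReal (δ ^ (-s)) * I) := by
        rw [lintegral_const_mul' _ _ ENNReal.ofReal_ne_top, ← hscale,
          lintegral_sub_right_eq_self (fun x => ENNReal.ofReal ((δ + ‖x‖) ^ (-(2 + s)))) u]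
    _ ≤ ENNReal.ofReal (3 ^ (2 + s)) *
          (ENNReal.ofReal (2 ^ s * (1 - ‖a‖ ^ 2) ^ (-s)) * I) := by
        gcongr
        have h1 : (2 * δ) ^ (-s) ≤ (1 - ‖a‖ ^ 2) ^ (-s) :=
          Real.rpow_le_rpow_of_nonpos (one_sub_norm_sq_pos ha)
            (by rw [hδ]; nlinarith [norm_nonneg a]) (by linarith)
        rw [Real.mul_rpow two_pos.le hδ0.le, Real.rpow_neg two_pos.le] at h1
        rwa [inv_mul_le_iff₀ (by positivity)] at h1
    _ = _ := by
        rw [ENNReal.ofReal_mul (by positivity), ENNReal.ofReal_mul (by positivity)]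
        ring

/-! ### The integration operator -/

lemma J_zero (g f : ℂ → ℂ) : J g f 0 = 0 := by simp [J]

/-- On the disc `f g'` has a holomorphic primitive, and `J_g f` differs from it by a constant. -/
lemma hasDerivAt_J {g f : ℂ → ℂ} (hg : DifferentiableOn ℂ g disc)
    (hf : DifferentiableOn ℂ f disc) {z : ℂ} (hz : z ∈ disc) :
    HasDerivAt (J g f) (f z * deriv g z) z := by
  have hfg : DifferentiableOn ℂ (fun z => f z * deriv g z) disc :=
    hf.mul (hg.deriv Metric.isOpen_ball)
  obtain ⟨F, hF⟩ := hfg.isExactOn_ball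
  have hJ : ∀ w ∈ disc, J g f w = F w - F 0 := fun w hw => by
    have hmem : ∀ t ∈ uIcc (0 : ℝ) 1, (t : ℂ) * w ∈ disc := fun t ht => by
      rw [uIcc_of_le zero_le_one] at ht
      rw [disc, mem_ball_zero_iff, norm_mul, Complex.norm_real, Real.norm_of_nonneg ht.1]
      nlinarith [ht.2, norm_nonneg w, norm_lt_one_of_mem_disc hw]
    have h2 : ∀ t : ℝ, HasDerivAt (fun t : ℝ => (t : ℂ) * w) w t := fun t => by
      simpa using (Complex.ofRealCLM.hasDerivAt (x := t)).mul_const w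
    have h3 := intervalIntegral.integral_eq_sub_of_hasDerivAt (a := 0) (b := 1)
      (f := fun t : ℝ => F (t * w)) (f' := fun t : ℝ => f (t * w) * deriv g (t * w) * w)
      (fun t ht => (hF _ (hmem t ht)).comp t (h2 t))
      (ContinuousOn.intervalIntegrable ((hfg.continuousOn.comp (by fun_prop) hmem).mul
        continuousOn_const))
    rw [J, h3]
    simp
  exact ((hF z hz).sub_const (F 0)).congr_of_eventuallyEq
    (Filter.eventually_of_mem (Metric.isOpen_ball.mem_nhds hz) hJ)

lemma differentiableOn_J {g f : ℂ → ℂ} (hg : DifferentiableOn ℂ g disc)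
    (hf : DifferentiableOn ℂ f disc) : DifferentiableOn ℂ (J g f) disc :=
  fun _ hz => (hasDerivAt_J hg hf hz).differentiableAt.differentiableWithinAt

/-! ### Boundedness of the integration operator -/

lemma energy_J (p : ℝ) {g f : ℂ → ℂ} (hg : DifferentiableOn ℂ g disc)
    (hf : DifferentiableOn ℂ f disc) (a : ℂ) :
    energy p a (J g f) = ∫⁻ z, ‖f z‖ₑ ^ 2 * (‖deriv g z‖ₑ ^ 2 *
      ENNReal.ofReal ((1 - ‖phi a z‖ ^ 2) ^ p)) ∂discMeasure := by
  refine lintegral_discMeasure_congr fun z hz => ?_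
  rw [(hasDerivAt_J hg hf hz).deriv, enorm_mul, mul_pow, mul_assoc]

/-- Since `J_g f` vanishes at the origin, boundedness of `J_g` is a uniform bound on weighted
energies. -/
lemma isBoundedOnMorrey_of_energy_le {p l : ℝ} {g : ℂ → ℂ} (hg : DifferentiableOn ℂ g disc)
    (h : ∃ M : ℝ≥0∞, M ≠ ∞ ∧ ∀ f, MemMorrey p l f → ∀ a ∈ disc,
      ENNReal.ofReal ((1 - ‖a‖ ^ 2) ^ (p * (1 - l))) * energy p a (J g f) ≤
        M * morreyNorm p l f ^ 2) : IsBoundedOnMorrey p l (J g) := by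
  obtain ⟨M, hM, h⟩ := h
  have hM' : M ^ (1 / 2 : ℝ) ≠ ∞ := ENNReal.rpow_ne_top_of_nonneg (by norm_num) hM
  refine ⟨(M ^ (1 / 2 : ℝ)).toNNReal, fun f hf => ?_⟩
  rw [ENNReal.coe_toNNReal hM']
  have hle : morreyNorm p l (J g f) ≤ M ^ (1 / 2 : ℝ) * morreyNorm p l f := by
    have h1 := morreyNorm_le_of_energy_le (p := p) (l := l) (differentiableOn_J hg hf.1)
      (K := M ^ (1 / 2 : ℝ) * morreyNorm p l f)
      (fun a ha => by rw [mul_pow, rpow_half_sq]; exact h f hf a ha)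
    simpa [J_zero] using h1
  exact ⟨⟨differentiableOn_J hg hf.1, hle.trans_lt (ENNReal.mul_lt_top hM'.lt_top hf.2)⟩, hle⟩

lemma MemQ.exists_energy_le {q : ℝ} {g : ℂ → ℂ} (hg : MemQ q g) :
    ∃ B : ℝ≥0∞, B ≠ ∞ ∧ ∀ a ∈ disc, energy q a g ≤ B := by
  refine ⟨(⨆ a ∈ disc, dirichletNorm q (hypTranslate g a)) ^ 2, ENNReal.pow_ne_top hg.2.ne,
    fun a ha => ?_⟩
  rw [← rpow_half_sq (energy q a g), ← dirichletNorm_hypTranslate q hg.1.1 ha]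
  exact pow_le_pow_left' (le_iSup₂ (f := fun a (_ : a ∈ disc) =>
    dirichletNorm q (hypTranslate g a)) a ha) 2

lemma enorm_sq_le_ofReal_sq {w : ℂ} {x : ℝ} (h : ‖w‖ ≤ x) : ‖w‖ₑ ^ 2 ≤ ENNReal.ofReal (x ^ 2) := by
  rw [← ofReal_norm, ← ENNReal.ofReal_pow (norm_nonneg _)]
  exact ENNReal.ofReal_le_ofReal (pow_le_pow_left₀ (norm_nonneg _) h 2)

/-- The growth factor `(1 - |z|²)^(-e)` costs only part of the Möbius weight: it turns the exponent
`q + e` into `q`. -/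
lemma weight_exchange {e : ℝ} (he : 0 ≤ e) (q : ℝ) {a z : ℂ} (ha : a ∈ disc) (hz : z ∈ disc) :
    (1 - ‖a‖ ^ 2) ^ e * ((1 - ‖z‖ ^ 2) ^ (-e) * (1 - ‖phi a z‖ ^ 2) ^ (q + e)) ≤
      4 ^ e * (1 - ‖phi a z‖ ^ 2) ^ q := by
  have hX := one_sub_norm_sq_pos ha
  have hZ := one_sub_norm_sq_pos hz
  have hd := norm_denom_pos ha hz
  have hW := one_sub_norm_sq_pos (phi_mem_disc ha hz)
  have h1 : (1 - ‖a‖ ^ 2) ^ e * ((1 - ‖z‖ ^ 2) ^ (-e) * (1 - ‖phi a z‖ ^ 2) ^ e) ≤ 4 ^ e := by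
    rw [Real.rpow_neg hZ.le, ← Real.inv_rpow hZ.le, ← Real.mul_rpow (by positivity) hW.le,
      ← Real.mul_rpow hX.le (by positivity)]
    refine Real.rpow_le_rpow (by positivity) ?_ he
    rw [one_sub_norm_phi_sq ha hz, inv_mul_eq_div, div_div, mul_comm (‖_‖ ^ 2) (1 - ‖z‖ ^ 2),
      mul_comm (1 - ‖a‖ ^ 2) (1 - ‖z‖ ^ 2), mul_div_mul_left _ _ hZ.ne', ← mul_div_assoc,
      div_le_iff₀ (by positivity)]
    nlinarith [one_sub_norm_sq_le ha hz]
  rw [Real.rpow_add hW]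
  calc _ = (1 - ‖a‖ ^ 2) ^ e * ((1 - ‖z‖ ^ 2) ^ (-e) * (1 - ‖phi a z‖ ^ 2) ^ e) *
        (1 - ‖phi a z‖ ^ 2) ^ q := by ring
    _ ≤ _ := by gcongr

/-- The growth estimate for `f` reduces the energy of `J_g f` to the `q`-energy of `g`. -/
theorem isBoundedOnMorrey_of_memQ {p q : ℝ} (hp : 0 < p) (hq : q < p) {g : ℂ → ℂ}
    (hg : MemQ q g) : IsBoundedOnMorrey p (q / p) (J g) := by
  obtain ⟨B, hB, hBg⟩ := hg.exists_energy_le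
  obtain ⟨C, hC, hgrow⟩ := exists_norm_le hp (l := q / p) ((div_lt_one hp).2 hq)
  have he : p * (1 - q / p) = p - q := by field_simp
  refine isBoundedOnMorrey_of_energy_le hg.1.1
    ⟨ENNReal.ofReal (C ^ 2 * 4 ^ (p - q)) * B, ENNReal.mul_ne_top ENNReal.ofReal_ne_top hB,
      fun f hf a ha => ?_⟩
  set N := (morreyNorm p (q / p) f).toReal with hN
  have hN0 : 0 ≤ N := ENNReal.toReal_nonneg
  have hNe : morreyNorm p (q / p) f = ENNReal.ofReal N := (ENNReal.ofReal_toReal hf.2.ne).symm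
  rw [energy_J p hg.1.1 hf.1, he, ← lintegral_const_mul' _ _ ENNReal.ofReal_ne_top]
  calc _ ≤ ∫⁻ z, ENNReal.ofReal (C ^ 2 * 4 ^ (p - q) * N ^ 2) * (‖deriv g z‖ₑ ^ 2 *
        ENNReal.ofReal ((1 - ‖phi a z‖ ^ 2) ^ q)) ∂discMeasure := by
        refine lintegral_discMeasure_mono fun z hz => ?_
        have hX := one_sub_norm_sq_pos ha
        have hZ := one_sub_norm_sq_pos hz
        have hW := one_sub_norm_sq_pos (phi_mem_disc ha hz)
        have h1 := enorm_sq_le_ofReal_sq (hgrow f hf z hz)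
        have h2 : (C * N * (1 - ‖z‖ ^ 2) ^ (-(p / 2 * (1 - q / p)))) ^ 2 =
            C ^ 2 * N ^ 2 * (1 - ‖z‖ ^ 2) ^ (-(p - q)) := by
          rw [mul_pow, mul_pow, ← Real.rpow_mul_natCast hZ.le, ← he]
          congr 2
          push_cast
          ring
        rw [h2] at h1
        have h3 := weight_exchange (sub_nonneg.2 hq.le) q ha hz
        rw [add_sub_cancel] at h3
        calc _ ≤ ENNReal.ofReal ((1 - ‖a‖ ^ 2) ^ (p - q)) *
              (ENNReal.ofReal (C ^ 2 * N ^ 2 * (1 - ‖z‖ ^ 2) ^ (-(p - q))) *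
                (‖deriv g z‖ₑ ^ 2 * ENNReal.ofReal ((1 - ‖phi a z‖ ^ 2) ^ p))) := by gcongr
          _ = ‖deriv g z‖ₑ ^ 2 * ENNReal.ofReal ((C ^ 2 * N ^ 2) * ((1 - ‖a‖ ^ 2) ^ (p - q) *
                ((1 - ‖z‖ ^ 2) ^ (-(p - q)) * (1 - ‖phi a z‖ ^ 2) ^ p))) := by
              repeat rw [ENNReal.ofReal_mul (by positivity)]
              ring
          _ ≤ ‖deriv g z‖ₑ ^ 2 * ENNReal.ofReal ((C ^ 2 * N ^ 2) *
                (4 ^ (p - q) * (1 - ‖phi a z‖ ^ 2) ^ q)) := by gcongr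
          _ = _ := by
              repeat rw [ENNReal.ofReal_mul (by positivity)]
              ring
    _ = ENNReal.ofReal (C ^ 2 * 4 ^ (p - q) * N ^ 2) * energy q a g := by
        rw [lintegral_const_mul' _ _ ENNReal.ofReal_ne_top, energy]
    _ ≤ ENNReal.ofReal (C ^ 2 * 4 ^ (p - q) * N ^ 2) * B := by gcongr; exact hBg a ha
    _ = _ := by
        rw [hNe, ENNReal.ofReal_mul (by positivity), ENNReal.ofReal_pow hN0]
        ring

/-- The test function `f(z) (1 - conj a z)^(-p)` for the Carleson condition; its modulus carries the
factor `|1 - conj a z|^(-2p)` of the Möbius weight. -/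
def testFun (p : ℝ) (a : ℂ) (f : ℂ → ℂ) (z : ℂ) : ℂ :=
  f z * (1 - (starRingEnd ℂ) a * z) ^ ((-p : ℝ) : ℂ)

lemma norm_testFun (p : ℝ) (a : ℂ) (f : ℂ → ℂ) (z : ℂ) :
    ‖testFun p a f z‖ = ‖f z‖ * ‖1 - (starRingEnd ℂ) a * z‖ ^ (-p) := by
  rw [testFun, norm_mul, Complex.norm_cpow_real]

lemma hasDerivAt_testFun (p : ℝ) {a z : ℂ} {f : ℂ → ℂ} (ha : a ∈ disc) (hz : z ∈ disc)
    (hf : DifferentiableOn ℂ f disc) :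
    HasDerivAt (testFun p a f) (deriv f z * (1 - (starRingEnd ℂ) a * z) ^ ((-p : ℝ) : ℂ) +
      f z * (p * (starRingEnd ℂ) a * (1 - (starRingEnd ℂ) a * z) ^ ((-p - 1 : ℝ) : ℂ))) z := by
  have h1 : HasDerivAt f (deriv f z) z :=
    (hf.differentiableAt (Metric.isOpen_ball.mem_nhds hz)).hasDerivAt
  have hslit : 1 - (starRingEnd ℂ) a * z ∈ Complex.slitPlane := by
    rw [sub_eq_add_neg]
    refine Complex.mem_slitPlane_of_norm_lt_one ?_
    rw [norm_neg, norm_mul, RCLike.norm_conj]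
    nlinarith [norm_lt_one_of_mem_disc ha, norm_lt_one_of_mem_disc hz, norm_nonneg a, norm_nonneg z]
  have h2 := (((hasDerivAt_id z).const_mul ((starRingEnd ℂ) a)).const_sub 1).cpow_const
    (c := ((-p : ℝ) : ℂ)) hslit
  refine (h1.mul h2).congr_deriv ?_
  push_cast
  simp only [id]
  ring

/-- Pointwise bound on the density of the test function for `f` with growth
`A (1 - |z|²)^(-p(1-l)/2)`. -/
lemma density_testFun_le {p l A : ℝ} (hp : 0 < p) (hl : 0 < l) (hA : 0 ≤ A) {a z : ℂ} {f : ℂ → ℂ}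
    (ha : a ∈ disc) (hz : z ∈ disc) (hf : DifferentiableOn ℂ f disc)
    (hgrow : ‖f z‖ ≤ A * (1 - ‖z‖ ^ 2) ^ (-(p / 2 * (1 - l)))) :
    density p (testFun p a f) z ≤
      2 * (‖deriv f z‖ₑ ^ 2 * ENNReal.ofReal
        ((1 - ‖z‖ ^ 2) ^ p * ‖1 - (starRingEnd ℂ) a * z‖ ^ (-(2 * p)))) +
      ENNReal.ofReal (2 * p ^ 2 * 2 ^ (p * l) * A ^ 2) *
        ENNReal.ofReal (‖1 - (starRingEnd ℂ) a * z‖ ^ (-(2 + p * (2 - l)))) := by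
  have hZ := one_sub_norm_sq_pos hz
  have hd := norm_denom_pos ha hz
  have hZd := one_sub_norm_sq_le_right ha hz
  rw [density, (hasDerivAt_testFun p ha hz hf).deriv]
  set d := ‖1 - (starRingEnd ℂ) a * z‖ with hdd
  set Z := 1 - ‖z‖ ^ 2 with hZZ
  set u := deriv f z * (1 - (starRingEnd ℂ) a * z) ^ ((-p : ℝ) : ℂ)
  set v := f z * (p * (starRingEnd ℂ) a * (1 - (starRingEnd ℂ) a * z) ^ ((-p - 1 : ℝ) : ℂ))
  have hu : ‖u‖ ^ 2 = ‖deriv f z‖ ^ 2 * d ^ (-(2 * p)) := by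
    rw [norm_mul, Complex.norm_cpow_real, mul_pow, ← hdd, ← Real.rpow_mul_natCast hd.le]
    congr 2
    push_cast; ring
  have hv : ‖v‖ ≤ A * Z ^ (-(p / 2 * (1 - l))) * (p * d ^ (-p - 1)) := by
    rw [norm_mul, norm_mul, norm_mul, Complex.norm_cpow_real, Complex.norm_real,
      Real.norm_of_nonneg hp.le, RCLike.norm_conj, ← hdd]
    gcongr
    exact mul_le_of_le_one_right hp.le (norm_lt_one_of_mem_disc ha).le
  have hv2 : ‖v‖ ^ 2 * Z ^ p ≤ p ^ 2 * 2 ^ (p * l) * A ^ 2 * d ^ (-(2 + p * (2 - l))) := by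
    have h1 : (Z ^ (-(p / 2 * (1 - l)))) ^ 2 * Z ^ p = Z ^ (p * l) := by
      rw [← Real.rpow_mul_natCast hZ.le, ← Real.rpow_add hZ]
      congr 1
      push_cast; ring
    have h2 : Z ^ (p * l) ≤ 2 ^ (p * l) * d ^ (p * l) := by
      rw [← Real.mul_rpow two_pos.le hd.le]
      exact Real.rpow_le_rpow hZ.le hZd (by positivity)
    have h3 : (d ^ (-p - 1)) ^ 2 * d ^ (p * l) = d ^ (-(2 + p * (2 - l))) := by
      rw [← Real.rpow_mul_natCast hd.le, ← Real.rpow_add hd]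
      congr 1
      push_cast; ring
    calc ‖v‖ ^ 2 * Z ^ p
        ≤ (A * Z ^ (-(p / 2 * (1 - l))) * (p * d ^ (-p - 1))) ^ 2 * Z ^ p := by gcongr
      _ = p ^ 2 * A ^ 2 * (d ^ (-p - 1)) ^ 2 * ((Z ^ (-(p / 2 * (1 - l)))) ^ 2 * Z ^ p) := by ring
      _ ≤ p ^ 2 * A ^ 2 * (d ^ (-p - 1)) ^ 2 * (2 ^ (p * l) * d ^ (p * l)) := by
          rw [h1]; gcongr
      _ = p ^ 2 * 2 ^ (p * l) * A ^ 2 * ((d ^ (-p - 1)) ^ 2 * d ^ (p * l)) := by ring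
      _ = _ := by rw [h3]
  have huv : ‖u + v‖ ^ 2 ≤ 2 * ‖u‖ ^ 2 + 2 * ‖v‖ ^ 2 := by
    have := norm_add_le u v
    nlinarith [norm_nonneg (u + v), norm_nonneg u, norm_nonneg v, sq_nonneg (‖u‖ - ‖v‖)]
  have hreal : ‖u + v‖ ^ 2 * Z ^ p ≤ 2 * (‖deriv f z‖ ^ 2 * (Z ^ p * d ^ (-(2 * p)))) +
      2 * p ^ 2 * 2 ^ (p * l) * A ^ 2 * d ^ (-(2 + p * (2 - l))) := by
    calc ‖u + v‖ ^ 2 * Z ^ p ≤ (2 * ‖u‖ ^ 2 + 2 * ‖v‖ ^ 2) * Z ^ p := by gcongr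
      _ = 2 * (‖u‖ ^ 2 * Z ^ p) + 2 * (‖v‖ ^ 2 * Z ^ p) := by ring
      _ ≤ 2 * (‖u‖ ^ 2 * Z ^ p) +
          2 * (p ^ 2 * 2 ^ (p * l) * A ^ 2 * d ^ (-(2 + p * (2 - l)))) := by gcongr
      _ = _ := by rw [hu]; ring
  have hE := ENNReal.ofReal_le_ofReal hreal
  rw [ENNReal.ofReal_add (by positivity) (by positivity), ENNReal.ofReal_mul (by positivity),
    ENNReal.ofReal_mul two_pos.le, ENNReal.ofReal_mul (by positivity),
    ENNReal.ofReal_mul (p := 2 * p ^ 2 * 2 ^ (p * l) * A ^ 2) (by positivity),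
    ENNReal.ofReal_pow (norm_nonneg _), ENNReal.ofReal_pow (norm_nonneg _), ofReal_norm,
    ofReal_norm, ENNReal.ofReal_ofNat] at hE
  exact hE

/-- Uniform bound for the normalized test functions: the loss `(1 - |a|²)^(-p(2-l))` in the
Forelli–Rudin estimate is exactly compensated by the normalization. -/
lemma exists_dirichletNorm_testFun_le {p l : ℝ} (hp : 0 < p) (hl0 : 0 < l) (hl1 : l < 1) :
    ∃ M : ℝ≥0∞, M ≠ ∞ ∧ ∀ f, MemMorrey p l f → ∀ a ∈ disc,
      ENNReal.ofReal ((1 - ‖a‖ ^ 2) ^ (p * (2 - l))) * dirichletNorm p (testFun p a f) ^ 2 ≤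
        M * morreyNorm p l f ^ 2 := by
  obtain ⟨C, hC, hgrow⟩ := exists_norm_le hp hl1
  have hs : 0 < p * (2 - l) := mul_pos hp (by linarith)
  obtain ⟨K, hK⟩ := exists_lintegral_norm_denom_rpow_le hs
  set D := 2 * p ^ 2 * 2 ^ (p * l) * C ^ 2 with hD
  refine ⟨1 + (2 + ENNReal.ofReal D * K), by finiteness, fun f hf a ha => ?_⟩
  have hX := one_sub_norm_sq_pos ha
  set X := 1 - ‖a‖ ^ 2 with hXX
  set N := (morreyNorm p l f).toReal with hN
  have hN0 : 0 ≤ N := ENNReal.toReal_nonneg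
  have hNe : morreyNorm p l f = ENNReal.ofReal N := (ENNReal.ofReal_toReal hf.2.ne).symm
  have hint : ∫⁻ z, density p (testFun p a f) z ∂discMeasure ≤
      2 * (∫⁻ z, ‖deriv f z‖ₑ ^ 2 * ENNReal.ofReal
        ((1 - ‖z‖ ^ 2) ^ p * ‖1 - (starRingEnd ℂ) a * z‖ ^ (-(2 * p))) ∂discMeasure) +
      ENNReal.ofReal D * morreyNorm p l f ^ 2 * (K * ENNReal.ofReal (X ^ (-(p * (2 - l))))) := by
    have hDN : ENNReal.ofReal D * morreyNorm p l f ^ 2 =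
        ENNReal.ofReal (2 * p ^ 2 * 2 ^ (p * l) * (C * N) ^ 2) := by
      rw [hNe, ← ENNReal.ofReal_pow hN0, ← ENNReal.ofReal_mul (by positivity)]
      congr 1
      ring
    rw [hDN]
    refine (lintegral_discMeasure_mono fun z hz =>
      density_testFun_le hp hl0 (by positivity) ha hz hf.1 (hgrow f hf z hz)).trans ?_
    rw [lintegral_add_right _ (by fun_prop), lintegral_const_mul' _ _ ENNReal.ofNat_ne_top,
      lintegral_const_mul' _ _ ENNReal.ofReal_ne_top]
    gcongr
    exact hK a ha
  have h0 : ENNReal.ofReal (X ^ (p * (2 - l))) * ‖testFun p a f 0‖ₑ ^ 2 ≤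
      morreyNorm p l f ^ 2 := by
    have h1 : ‖testFun p a f 0‖ₑ ≤ morreyNorm p l f := by
      rw [testFun, mul_zero, sub_zero, Complex.one_cpow, mul_one]
      exact le_self_add
    have h2 : X ^ (p * (2 - l)) ≤ 1 :=
      Real.rpow_le_one hX.le (by rw [hXX]; nlinarith [sq_nonneg ‖a‖]) hs.le
    calc _ ≤ 1 * morreyNorm p l f ^ 2 := by
          gcongr
          exact ENNReal.ofReal_le_one.2 h2
      _ = _ := one_mul _
  have hXs : ENNReal.ofReal (X ^ (p * (2 - l))) * ENNReal.ofReal (X ^ (-(p * (2 - l)))) = 1 := by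
    rw [← ENNReal.ofReal_mul (by positivity), ← Real.rpow_add hX, add_neg_cancel, Real.rpow_zero,
      ENNReal.ofReal_one]
  have hen := energy_le_of_memMorrey (p := p) (l := l) hf.1 ha
  rw [energy_eq p ha, ← mul_assoc, ← ENNReal.ofReal_mul (by positivity), ← Real.rpow_add hX,
    show p * (1 - l) + p = p * (2 - l) by ring] at hen
  rw [dirichletNorm_sq, mul_add, add_mul, one_mul]
  refine add_le_add h0 ((mul_le_mul_right hint _).trans ?_)
  rw [mul_add, add_mul]
  refine add_le_add ?_ (le_of_eq ?_)
  · rw [mul_left_comm]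
    exact mul_le_mul_right hen _
  · calc _ = ENNReal.ofReal D * K * morreyNorm p l f ^ 2 *
          (ENNReal.ofReal (X ^ (p * (2 - l))) * ENNReal.ofReal (X ^ (-(p * (2 - l))))) := by ring
      _ = _ := by rw [hXs, mul_one]

/-- The Carleson inequality for `g` is applied to the test functions `testFun p a f`. -/
theorem isBoundedOnMorrey_of_memW {p l : ℝ} (hp : 0 < p) (hl0 : 0 < l) (hl1 : l < 1) {g : ℂ → ℂ}
    (hg : MemW p g) : IsBoundedOnMorrey p l (J g) := by
  obtain ⟨M, hM, hMf⟩ := exists_dirichletNorm_testFun_le hp hl0 hl1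
  obtain ⟨C, hC⟩ := hg.2
  refine isBoundedOnMorrey_of_energy_le hg.1 ⟨C * M, by finiteness, fun f hf a ha => ?_⟩
  have hX := one_sub_norm_sq_pos ha
  set X := 1 - ‖a‖ ^ 2 with hXX
  have hX0 : ENNReal.ofReal (X ^ (p * (2 - l))) ≠ 0 := by
    simpa using Real.rpow_pos_of_pos hX _
  have hmem : MemDirichlet p (testFun p a f) := by
    refine ⟨fun z hz => (hasDerivAt_testFun p ha hz hf.1).differentiableAt.differentiableWithinAt,
      lt_top_iff_ne_top.2 fun htop => ?_⟩
    have h1 := hMf f hf a ha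
    rw [htop, ENNReal.top_pow two_ne_zero, ENNReal.mul_top hX0, top_le_iff] at h1
    exact ENNReal.mul_ne_top hM (ENNReal.pow_ne_top hf.2.ne) h1
  have hdens : Measurable (density p g) := by
    have := measurable_deriv g
    unfold density
    fun_prop
  have hcarl := hC _ hmem
  -- `testFun p a f` need not be measurable off the disc, hence the version without measurability
  rw [setLIntegral_withDensity_eq_setLIntegral_mul_non_measurable _ hdens _
    Metric.isOpen_ball.measurableSet (ae_of_all _ fun z => by
      unfold density; exact ENNReal.mul_lt_top (by finiteness) ENNReal.ofReal_lt_top),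
    Measure.restrict_eq_self_of_ae_mem ae_discMeasure] at hcarl
  have hJ : ENNReal.ofReal (X ^ (p * (1 - l))) * energy p a (J g f) =
      ENNReal.ofReal (X ^ (p * (2 - l))) *
        ∫⁻ z, (density p g * fun z => ‖testFun p a f z‖ₑ ^ 2) z ∂discMeasure := by
    rw [energy_eq p ha, ← mul_assoc, ← ENNReal.ofReal_mul (by positivity), ← Real.rpow_add hX,
      show p * (1 - l) + p = p * (2 - l) by ring]
    congr 1
    refine lintegral_discMeasure_congr fun z hz => ?_
    have hZ := one_sub_norm_sq_pos hz
    have hd := norm_denom_pos ha hz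
    have h1 : ‖testFun p a f z‖ₑ ^ 2 =
        ‖f z‖ₑ ^ 2 * ENNReal.ofReal (‖1 - (starRingEnd ℂ) a * z‖ ^ (-(2 * p))) := by
      rw [← ofReal_norm, norm_testFun, ENNReal.ofReal_mul (norm_nonneg _), mul_pow, ofReal_norm,
        ofReal_rpow_sq hd, mul_neg]
    rw [(hasDerivAt_J hg.1 hf.1 hz).deriv, Pi.mul_apply, h1, density, enorm_mul, mul_pow,
      ENNReal.ofReal_mul (by positivity)]
    ring
  rw [hJ]
  calc _ ≤ ENNReal.ofReal (X ^ (p * (2 - l))) * (C * dirichletNorm p (testFun p a f) ^ 2) :=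
        mul_le_mul_right hcarl _
    _ = C * (ENNReal.ofReal (X ^ (p * (2 - l))) * dirichletNorm p (testFun p a f) ^ 2) := by ring
    _ ≤ C * (M * morreyNorm p l f ^ 2) := mul_le_mul_right (hMf f hf a ha) _
    _ = _ := (mul_assoc _ _ _).symm

end DirichletMorrey

end

theorem theorem3p4 (p : ℝ) (hp0 : 0 < p) (hp1 : p < 1) :
    (∀ (q : ℝ) (g : ℂ → ℂ), 0 < q → q < p → DirichletMorrey.MemQ q g →
      DirichletMorrey.IsBoundedOnMorrey p (q / p) (DirichletMorrey.J g)) ∧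
    (∀ (l : ℝ) (g : ℂ → ℂ), 0 < l → l < 1 → DirichletMorrey.MemW p g →
      DirichletMorrey.IsBoundedOnMorrey p l (DirichletMorrey.J g)) :=
  ⟨fun _ _ _ hq hg => DirichletMorrey.isBoundedOnMorrey_of_memQ hp0 hq hg,
    fun _ _ hl0 hl1 hg => DirichletMorrey.isBoundedOnMorrey_of_memW hp0 hl0 hl1 hg⟩
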